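/- Let $d_1,d_2\ge 0$ be integers with $d := d_1+d_2\ge 1$, let $R\ge 0$, and let $Z_1,\dots,Z_n$ ($n\ge 0$) be independent random matrices with values in $\mathbb{C}^{d_1\times d_2}$ such that $$\mathbb{E} Z_k = 0 \quad\text{and}\quad \|Z_k\|\le R \ \text{ almost surely, for each } k ,$$ where $\|\cdot\|$ denotes the spectral norm (largest singular value). Put $$\sigma^2 := \max\Big\{ \Big\|\sum_k \mathbb{E}(Z_kZ_k^*)\Big\|,\ \Big\|\sum_k \mathbb{E}(Z_k^*Z_k)\Big\| \Big\},\qquad \sigma\ge 0 .$$ Then, for all $t\ge 0$, $$\mathbb{P}\Big\{\Big\|\sum_k Z_k\Big\|\ge t\Big\}\ \le\ d\cdot\exp\Big\{\frac{-t^2}{3\sigma^2+2Rt}\Big\}.$$ If the denominator $3\sigma^2+2Rt$ is zero, the exponential is read as $0$ when $t>0$ and as $1$ when $t=0$. Furthermore, $\|\sum_k Z_k\|$ is integrable and $$\mathbb{E}\Big\|\sum_k Z_k\Big\|\ \le\ \sigma\sqrt{3\log d}+R\log d .$$ -/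

import Mathlib

open MeasureTheory ProbabilityTheory
open scoped Matrix Matrix.Norms.L2Operator

/-- The Borel σ-algebra on complex matrices, for the usual (entrywise, equivalently norm)
topology. -/
noncomputable instance matrixMeasurableSpace (d₁ d₂ : ℕ) : MeasurableSpace (Matrix (Fin d₁) (Fin d₂) ℂ) :=
  borel _

instance matrixBorelSpace (d₁ d₂ : ℕ) : BorelSpace (Matrix (Fin d₁) (Fin d₂) ℂ) :=
  ⟨rfl⟩

/-- The variance measure `σ²` of a finite family of random complex matrices: the larger of the
spectral norms of `∑ E (Z_k Z_k*)` and `∑ E (Z_k* Z_k)`. Here `‖·‖` is the spectral norm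
(the operator norm between Euclidean spaces). -/
noncomputable def matrixVariance {Ω : Type*} [MeasurableSpace Ω] (μ : Measure Ω)
    {d₁ d₂ n : ℕ} (Z : Fin n → Ω → Matrix (Fin d₁) (Fin d₂) ℂ) : ℝ :=
  max ‖∑ k, ∫ ω, Z k ω * (Z k ω)ᴴ ∂μ‖ ‖∑ k, ∫ ω, (Z k ω)ᴴ * Z k ω ∂μ‖

/-! ### Trace inequalities for exponentials of Hermitian matrices. -/

section TraceInequalities

open Matrix
open scoped ComplexOrder MatrixOrder

variable {ι : Type*} [Fintype ι] [DecidableEq ι]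

/-! The method is that of exchangeable pairs, applied to a trace moment generating function. The
Hermitian dilation D(Z), with off-diagonal blocks Z and Z*, is real-linear, has norm at most ‖Z‖,
and satisfies exp(θ‖Z‖) ≤ tr exp(θD(Z)). With X = ∑ D(Z_k) it therefore suffices to bound M(θ) = E
tr exp(θX), where M'(θ) = ∑ E tr(D(Z_k) exp(θX)).

Fix k and condition on the other summands. Let Y = D(Z_k), let Y' be an independent copy, and let e,
e' be the corresponding exponentials. Since E Y = 0, E tr(Y e) is half of E tr((Y - Y')(e - e')).
The mean value inequality `trace_mul_exp_sub_exp_le` bounds this by second-order terms, among them E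
tr(Y² e). Applied to Y² - Y'², the same inequality compares E tr(Y² e) with E tr((E Y²) e), up to a
relative error governed by cθ with c = 3R/4. This is `integral_trace_mul_exp_le`.

As D(Z)² is block diagonal with blocks ZZ* and Z*Z, ∑ E D(Z_k)² ≤ σ²·1. Summing over k gives (1 -
cθ) M'(θ) ≤ σ²θ M(θ), which integrates to M(θ) ≤ d exp(σ²θ²/(2(1 - cθ))). Markov's inequality then
yields the tail bound and Jensen's inequality the mean bound. -/

theorem exp_sub_exp_le_mul_avg {x y : ℝ} (h : y ≤ x) :
    Real.exp x - Real.exp y ≤ (x - y) * ((Real.exp x + Real.exp y) / 2) := by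
  -- This is the claim for t = x - y after division by exp y. Nonnegativity of the derivative
  -- amounts to exp(-s) ≥ 1 - s.
  have key : ∀ t : ℝ, 0 ≤ t → 0 ≤ t * (Real.exp t + 1) / 2 - (Real.exp t - 1) := by
    intro t ht
    have hder : ∀ s : ℝ, HasDerivAt (fun s => s * (Real.exp s + 1) / 2 - (Real.exp s - 1))
        ((1 * (Real.exp s + 1) + s * Real.exp s) / 2 - Real.exp s) s := fun s =>
      (((hasDerivAt_id s).mul ((Real.hasDerivAt_exp s).add_const 1)).div_const 2).sub
        ((Real.hasDerivAt_exp s).sub_const 1)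
    have hmono := monotoneOn_of_deriv_nonneg (convex_Ici (0 : ℝ))
      (f := fun s => s * (Real.exp s + 1) / 2 - (Real.exp s - 1))
      (fun s _ => (hder s).continuousAt.continuousWithinAt)
      (fun s _ => (hder s).differentiableAt.differentiableWithinAt)
      (fun s _ => by
        rw [(hder s).deriv]
        have h1 := Real.add_one_le_exp (-s)
        have h2 : Real.exp s * Real.exp (-s) = 1 := by rw [← Real.exp_add]; simp
        nlinarith [Real.exp_pos s])
    simpa using hmono Set.self_mem_Ici ht ht
  have h1 := key (x - y) (sub_nonneg.2 h)
  have h2 : Real.exp x = Real.exp (x - y) * Real.exp y := by rw [← Real.exp_add]; simp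
  rw [h2]
  nlinarith [Real.exp_pos y]

theorem abs_exp_sub_exp_le (x y : ℝ) :
    |Real.exp x - Real.exp y| ≤ |x - y| * ((Real.exp x + Real.exp y) / 2) := by
  rcases le_total y x with h | h
  · rw [abs_of_nonneg (sub_nonneg.2 h), abs_of_nonneg (sub_nonneg.2 (Real.exp_le_exp.2 h))]
    exact exp_sub_exp_le_mul_avg h
  · rw [abs_sub_comm, abs_sub_comm x, add_comm, abs_of_nonneg (sub_nonneg.2 h),
      abs_of_nonneg (sub_nonneg.2 (Real.exp_le_exp.2 h))]
    exact exp_sub_exp_le_mul_avg h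

/-- Simultaneous diagonalization of a Hermitian matrix and its exponential. -/
theorem Matrix.IsHermitian.exists_diagonalization {A : Matrix ι ι ℂ} (hA : A.IsHermitian) :
    ∃ U : Matrix ι ι ℂ, Uᴴ * U = 1 ∧ U * Uᴴ = 1 ∧
      A = U * diagonal (fun i => (hA.eigenvalues i : ℂ)) * Uᴴ ∧
      NormedSpace.exp A = U * diagonal (fun i => (Real.exp (hA.eigenvalues i) : ℂ)) * Uᴴ := by
  let U : Matrix ι ι ℂ := (hA.eigenvectorUnitary : unitary (Matrix ι ι ℂ)).1
  have h1 : Uᴴ * U = 1 := Unitary.coe_star_mul_self hA.eigenvectorUnitary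
  have h2 : U * Uᴴ = 1 := Unitary.coe_mul_star_self hA.eigenvectorUnitary
  have hinv : U⁻¹ = Uᴴ := Matrix.inv_eq_left_inv h1
  have hA' : A = U * diagonal (fun i => (hA.eigenvalues i : ℂ)) * Uᴴ := hA.spectral_theorem
  refine ⟨U, h1, h2, hA', ?_⟩
  conv_lhs => rw [hA']
  rw [← hinv, Matrix.exp_conj _ _ ⟨⟨U, Uᴴ, h2, h1⟩, rfl⟩, Matrix.exp_diagonal]
  congr 3
  funext i
  rw [Pi.coe_exp, ← Complex.exp_eq_exp_ℂ, Complex.ofReal_exp]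

theorem trace_mul_conjTranspose_mul_diagonal (M : Matrix ι ι ℂ) (w : ι → ℝ) :
    (Mᴴ * M * diagonal (fun i => (w i : ℂ))).trace.re = ∑ j, ∑ i, ‖M j i‖ ^ 2 * w i := by
  rw [Finset.sum_comm]
  simp only [trace, diag_apply, mul_diagonal, Complex.re_sum]
  refine Finset.sum_congr rfl fun i _ => ?_
  rw [mul_apply, Finset.sum_mul, Complex.re_sum]
  refine Finset.sum_congr rfl fun j _ => ?_
  rw [conjTranspose_apply, Complex.re_mul_ofReal, Complex.star_def, Complex.conj_mul',
    ← Complex.ofReal_pow, Complex.ofReal_re]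

/-- The unitary V is free. Using the eigenbases of A and B in both orders lets the traces against
exp A and exp B share the same coefficients. -/
theorem trace_mul_self_mul_exp_eq_sum {D U V : Matrix ι ι ℂ} (hD : D.IsHermitian)
    (hV : V * Vᴴ = 1) (w : ι → ℝ) :
    (D * D * (U * diagonal (fun i => (w i : ℂ)) * Uᴴ)).trace.re =
      ∑ j, ∑ i, ‖(Vᴴ * D * U) j i‖ ^ 2 * w i := by
  rw [← trace_mul_conjTranspose_mul_diagonal]
  congr 1
  rw [← Matrix.mul_assoc, trace_mul_comm]
  congr 1
  simp only [conjTranspose_mul, conjTranspose_conjTranspose, hD.eq, Matrix.mul_assoc]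
  congr 2
  simp only [← Matrix.mul_assoc, hV, Matrix.one_mul]

/-- The mean value trace inequality for the exponential. -/
theorem trace_mul_exp_sub_exp_le {A B C : Matrix ι ι ℂ} (hA : A.IsHermitian)
    (hB : B.IsHermitian) (hC : C.IsHermitian) {r : ℝ} (hr : 0 < r) :
    (C * (NormedSpace.exp A - NormedSpace.exp B)).trace.re ≤
      (1 / 4) * (r * ((A - B) * (A - B) * (NormedSpace.exp A + NormedSpace.exp B)).trace.re +
        r⁻¹ * (C * C * (NormedSpace.exp A + NormedSpace.exp B)).trace.re) := by
  obtain ⟨U, hU1, hU2, hAU, hAe⟩ := hA.exists_diagonalization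
  obtain ⟨V, hV1, hV2, hBV, hBe⟩ := hB.exists_diagonalization
  set a := hA.eigenvalues
  set b := hB.eigenvalues
  have quad : ∀ D : Matrix ι ι ℂ, D.IsHermitian →
      (D * D * (NormedSpace.exp A + NormedSpace.exp B)).trace.re =
        ∑ j, ∑ i, ‖(Vᴴ * D * U) j i‖ ^ 2 * (Real.exp (a i) + Real.exp (b j)) := by
    intro D hD
    rw [Matrix.mul_add, trace_add, Complex.add_re, hAe, hBe,
      trace_mul_self_mul_exp_eq_sum hD hV2, trace_mul_self_mul_exp_eq_sum hD hU2,
      Finset.sum_comm (s := Finset.univ) (t := Finset.univ)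
        (f := fun j i => ‖(Uᴴ * D * V) j i‖ ^ 2 * Real.exp (b i)), ← Finset.sum_add_distrib]
    refine Finset.sum_congr rfl fun j _ => ?_
    rw [← Finset.sum_add_distrib]
    refine Finset.sum_congr rfl fun i _ => ?_
    have : ‖(Uᴴ * D * V) i j‖ = ‖(Vᴴ * D * U) j i‖ := by
      have e : Uᴴ * D * V = (Vᴴ * D * U)ᴴ := by
        simp [conjTranspose_mul, hD.eq, Matrix.mul_assoc]
      rw [e, conjTranspose_apply, norm_star]
    rw [this, mul_add]
  -- Overlaps of the two eigenbases. In these coordinates A - B and exp A - exp B act on W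
  -- entrywise, by a_i - b_j and exp a_i - exp b_j, so the scalar inequality applies entry by entry.
  set W := Vᴴ * U with hW
  have hD : ∀ j i, (Vᴴ * (A - B) * U) j i = ((a i - b j : ℝ) : ℂ) * W j i := by
    intro j i
    have : Vᴴ * (A - B) * U = W * diagonal (fun i => (a i : ℂ)) -
        diagonal (fun i => (b i : ℂ)) * W := by
      rw [Matrix.mul_sub, Matrix.sub_mul]
      congr 1
      · rw [hAU, hW]; simp only [Matrix.mul_assoc, hU1, Matrix.mul_one]
      · rw [hBV, hW]; simp only [← Matrix.mul_assoc, hV1, Matrix.one_mul]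
    rw [this, Matrix.sub_apply, mul_diagonal, diagonal_mul]
    push_cast; ring
  have hlin : (C * (NormedSpace.exp A - NormedSpace.exp B)).trace =
      ∑ j, ∑ i, (Vᴴ * C * U) j i * star (W j i) *
        ((Real.exp (a i) - Real.exp (b j) : ℝ) : ℂ) := by
    have e1 : (C * NormedSpace.exp A).trace =
        ∑ j, ∑ i, (Vᴴ * C * U) j i * star (W j i) * (Real.exp (a i) : ℂ) := by
      have : (C * NormedSpace.exp A).trace =
          (Vᴴ * C * U * diagonal (fun i => (Real.exp (a i) : ℂ)) * Wᴴ).trace := by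
        rw [hW, conjTranspose_mul, conjTranspose_conjTranspose, ← Matrix.mul_assoc _ Uᴴ V,
          trace_mul_comm _ V, hAe]
        simp only [← Matrix.mul_assoc, hV2, Matrix.one_mul]
      rw [this, trace]
      refine Finset.sum_congr rfl fun j _ => ?_
      rw [diag_apply, mul_apply]
      refine Finset.sum_congr rfl fun i _ => ?_
      rw [mul_diagonal, conjTranspose_apply]; ring
    have e2 : (C * NormedSpace.exp B).trace =
        ∑ j, ∑ i, (Vᴴ * C * U) j i * star (W j i) * (Real.exp (b j) : ℂ) := by
      have : (C * NormedSpace.exp B).trace =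
          (diagonal (fun i => (Real.exp (b i) : ℂ)) * (Vᴴ * C * U) * Wᴴ).trace := by
        rw [hW, conjTranspose_mul, conjTranspose_conjTranspose, ← Matrix.mul_assoc _ Uᴴ V,
          trace_mul_comm _ V, hBe, trace_mul_comm C]
        simp only [Matrix.mul_assoc, hU2, Matrix.mul_one]
      rw [this, trace]
      refine Finset.sum_congr rfl fun j _ => ?_
      rw [diag_apply, mul_apply]
      refine Finset.sum_congr rfl fun i _ => ?_
      rw [diagonal_mul, conjTranspose_apply]; ring
    rw [Matrix.mul_sub, trace_sub, e1, e2, ← Finset.sum_sub_distrib]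
    refine Finset.sum_congr rfl fun j _ => ?_
    rw [← Finset.sum_sub_distrib]
    refine Finset.sum_congr rfl fun i _ => ?_
    push_cast; ring
  rw [quad _ (hA.sub hB), quad _ hC, hlin, Complex.re_sum, Finset.mul_sum, Finset.mul_sum,
    ← Finset.sum_add_distrib, Finset.mul_sum]
  refine Finset.sum_le_sum fun j _ => ?_
  rw [Complex.re_sum, Finset.mul_sum, Finset.mul_sum, ← Finset.sum_add_distrib, Finset.mul_sum]
  refine Finset.sum_le_sum fun i _ => ?_
  refine (Complex.re_le_norm _).trans ?_
  rw [hD, norm_mul, norm_mul, norm_star, norm_mul, Complex.norm_real, Complex.norm_real,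
    Real.norm_eq_abs, Real.norm_eq_abs]
  set x := ‖W j i‖
  set y := ‖(Vᴴ * C * U) j i‖
  set s := Real.exp (a i) + Real.exp (b j) with hs
  have hs0 : 0 ≤ s := by positivity
  have h1 : y * x * |Real.exp (a i) - Real.exp (b j)| ≤ y * x * (|a i - b j| * (s / 2)) :=
    mul_le_mul_of_nonneg_left (abs_exp_sub_exp_le _ _) (by positivity)
  refine h1.trans ?_
  set z := |a i - b j|
  -- Young's inequality with weight r separates the entry of A - B from the entry of C.
  have h2 : 2 * (z * x) * y ≤ r * (z * x) ^ 2 + r⁻¹ * y ^ 2 := by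
    have : 0 ≤ r⁻¹ * (r * (z * x) - y) ^ 2 := by positivity
    have e : r⁻¹ * (r * (z * x) - y) ^ 2 =
        r * (z * x) ^ 2 + r⁻¹ * y ^ 2 - 2 * (z * x) * y := by field_simp; ring
    linarith
  nlinarith [mul_le_mul_of_nonneg_right h2 hs0]

theorem trace_mul_nonneg_of_posSemidef {P Q : Matrix ι ι ℂ} (hP : P.PosSemidef)
    (hQ : Q.PosSemidef) : 0 ≤ (P * Q).trace.re := by
  obtain ⟨S, rfl⟩ := CStarAlgebra.nonneg_iff_eq_star_mul_self.1 (nonneg_iff_posSemidef.2 hQ)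
  rw [← Matrix.mul_assoc, trace_mul_comm, ← Matrix.mul_assoc]
  exact (Complex.le_def.1 (hP.mul_mul_conjTranspose_same S).trace_nonneg).1

theorem Matrix.IsHermitian.posSemidef_exp {A : Matrix ι ι ℂ} (hA : A.IsHermitian) :
    (NormedSpace.exp A).PosSemidef := by
  obtain ⟨U, -, -, -, h⟩ := hA.exists_diagonalization
  rw [h]
  refine PosSemidef.mul_mul_conjTranspose_same (posSemidef_diagonal_iff.2 fun i => ?_) U
  exact Complex.zero_le_real.2 (Real.exp_pos _).le

theorem Matrix.IsHermitian.posSemidef_smul_one_sub {A : Matrix ι ι ℂ} (hA : A.IsHermitian)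
    {r : ℝ} (hr : ‖A‖ ≤ r) : (r • (1 : Matrix ι ι ℂ) - A).PosSemidef := by
  rw [← Matrix.le_iff, ← Algebra.algebraMap_eq_smul_one]
  exact (IsSelfAdjoint.le_algebraMap_norm_self hA).trans (algebraMap_mono _ hr)

theorem trace_mul_le_trace_mul {P P' Q : Matrix ι ι ℂ} (hP : (P' - P).PosSemidef)
    (hQ : Q.PosSemidef) : (P * Q).trace.re ≤ (P' * Q).trace.re := by
  have := trace_mul_nonneg_of_posSemidef hP hQ
  rw [Matrix.sub_mul, trace_sub, Complex.sub_re] at this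
  linarith

theorem Matrix.IsHermitian.mul_self {κ : Type*} [Fintype κ] {A : Matrix κ κ ℂ}
    (hA : A.IsHermitian) : (A * A).IsHermitian := by
  rw [IsHermitian, conjTranspose_mul, hA.eq]

/-- The difference equals 2Y(R² - Y²)Y + 2Y'(R² - Y'²)Y' + (Y² + Y'²)², a sum of positive
semidefinite terms. -/
theorem posSemidef_sq_sub_sq_sq {Y Y' : Matrix ι ι ℂ} (hY : Y.IsHermitian)
    (hY' : Y'.IsHermitian) {R : ℝ} (hR : ‖Y‖ ≤ R) (hR' : ‖Y'‖ ≤ R) :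
    ((2 * R ^ 2) • (Y * Y + Y' * Y') -
      (Y * Y - Y' * Y') * (Y * Y - Y' * Y')).PosSemidef := by
  have aux : ∀ X : Matrix ι ι ℂ, X.IsHermitian → ‖X‖ ≤ R →
      (X * (R ^ 2 • (1 : Matrix ι ι ℂ) - X * X) * X).PosSemidef := by
    intro X hX hXR
    have h1 : ‖X * X‖ ≤ R ^ 2 := by
      refine (norm_mul_le _ _).trans ?_
      nlinarith [norm_nonneg X]
    have := (hX.mul_self.posSemidef_smul_one_sub h1).mul_mul_conjTranspose_same X
    rwa [hX.eq] at this
  have hS : ((Y * Y + Y' * Y') * (Y * Y + Y' * Y')).PosSemidef := by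
    have := posSemidef_self_mul_conjTranspose (Y * Y + Y' * Y')
    rwa [(hY.mul_self.add hY'.mul_self).eq] at this
  have h1 := aux Y hY hR
  have h2 := aux Y' hY' hR'
  convert ((h1.add h1).add (h2.add h2)).add hS using 1
  simp only [Matrix.mul_sub, Matrix.sub_mul, Matrix.mul_add, Matrix.add_mul, mul_smul_comm,
    smul_mul_assoc, Matrix.mul_one, Matrix.mul_assoc, smul_add, two_mul, add_smul]
  abel

/-- The exponents differ by θ(Y - Y'), so the weight r = 1/θ makes the two quadratic terms equal. -/
theorem trace_sub_mul_exp_sub_exp_le {H Y Y' : Matrix ι ι ℂ} (hH : H.IsHermitian)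
    (hY : Y.IsHermitian) (hY' : Y'.IsHermitian) {θ : ℝ} (hθ : 0 < θ) :
    ((Y - Y') * (NormedSpace.exp (θ • (H + Y)) - NormedSpace.exp (θ • (H + Y')))).trace.re ≤
      θ / 2 * ((Y - Y') * (Y - Y') *
        (NormedSpace.exp (θ • (H + Y)) + NormedSpace.exp (θ • (H + Y')))).trace.re := by
  have hs : ∀ X : Matrix ι ι ℂ, X.IsHermitian → (θ • (H + X)).IsHermitian := fun X hX =>
    (hH.add hX).smul (IsSelfAdjoint.all θ)
  have h := trace_mul_exp_sub_exp_le (hs Y hY) (hs Y' hY') (hY.sub hY') (inv_pos.2 hθ)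
  have e : θ • (H + Y) - θ • (H + Y') = θ • (Y - Y') := by
    rw [← smul_sub, add_sub_add_left_eq_sub]
  rw [e, inv_inv] at h
  simp only [smul_mul_assoc, mul_smul_comm, smul_smul, trace_smul, Complex.smul_re,
    smul_eq_mul] at h
  refine h.trans (le_of_eq ?_)
  field_simp
  ring

/-- The weight r = R/θ gives both quadratic terms a common factor Rθ once (Y² - Y'²)² is replaced by
2R²(Y² + Y'²). This choice requires R > 0. -/
theorem trace_sq_sub_sq_mul_exp_sub_exp_le {H Y Y' : Matrix ι ι ℂ} (hH : H.IsHermitian)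
    (hY : Y.IsHermitian) (hY' : Y'.IsHermitian) {R : ℝ} (hR : 0 < R) (hYR : ‖Y‖ ≤ R)
    (hYR' : ‖Y'‖ ≤ R) {θ : ℝ} (hθ : 0 < θ) :
    ((Y * Y - Y' * Y') *
        (NormedSpace.exp (θ • (H + Y)) - NormedSpace.exp (θ • (H + Y')))).trace.re ≤
      R * θ / 4 * (((Y - Y') * (Y - Y') + (2 : ℝ) • (Y * Y + Y' * Y')) *
        (NormedSpace.exp (θ • (H + Y)) + NormedSpace.exp (θ • (H + Y')))).trace.re := by
  have hs : ∀ X : Matrix ι ι ℂ, X.IsHermitian → (θ • (H + X)).IsHermitian := fun X hX =>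
    (hH.add hX).smul (IsSelfAdjoint.all θ)
  have h := trace_mul_exp_sub_exp_le (hs Y hY) (hs Y' hY') (hY.mul_self.sub hY'.mul_self) (div_pos hR hθ)
  have h2 := trace_mul_le_trace_mul (posSemidef_sq_sub_sq_sq hY hY' hYR hYR')
    ((hs Y hY).posSemidef_exp.add (hs Y' hY').posSemidef_exp)
  have e : θ • (H + Y) - θ • (H + Y') = θ • (Y - Y') := by
    rw [← smul_sub, add_sub_add_left_eq_sub]
  rw [e] at h
  rw [Matrix.add_mul, trace_add, Complex.add_re]
  simp only [smul_mul_assoc, mul_smul_comm, smul_smul, trace_smul, Complex.smul_re,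
    smul_eq_mul] at h h2 ⊢
  refine h.trans ?_
  have h3 := mul_le_mul_of_nonneg_left h2 (div_pos hR hθ |> inv_pos.2).le
  refine (mul_le_mul_of_nonneg_left (add_le_add_right h3 _) (by norm_num)).trans (le_of_eq ?_)
  field_simp

end TraceInequalities

/-! ### The exchangeable pair estimate for one summand. -/

section SingleSummand

/-- `f` is integrable with integral `c`. -/
def HasMean {E F : Type*} [MeasurableSpace E] [NormedAddCommGroup F] [NormedSpace ℝ F]
    (ν : Measure E) (f : E → F) (c : F) : Prop :=
  Integrable f ν ∧ ∫ x, f x ∂ν = c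

namespace HasMean

variable {E F G : Type*} [MeasurableSpace E] [NormedAddCommGroup F] [NormedSpace ℝ F]
  [NormedAddCommGroup G] [NormedSpace ℝ G] {ν : Measure E} {f g : E → F} {c d : F}

theorem add (hf : HasMean ν f c) (hg : HasMean ν g d) :
    HasMean ν (fun x => f x + g x) (c + d) :=
  ⟨hf.1.add hg.1, by rw [integral_add hf.1 hg.1, hf.2, hg.2]⟩

theorem sub (hf : HasMean ν f c) (hg : HasMean ν g d) :
    HasMean ν (fun x => f x - g x) (c - d) :=
  ⟨hf.1.sub hg.1, by rw [integral_sub hf.1 hg.1, hf.2, hg.2]⟩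

theorem const [IsProbabilityMeasure ν] [CompleteSpace F] (c : F) : HasMean ν (fun _ => c) c :=
  ⟨integrable_const c, by simp⟩

theorem map [CompleteSpace F] [CompleteSpace G] (hf : HasMean ν f c) (L : F →L[ℝ] G) :
    HasMean ν (fun x => L (f x)) (L c) :=
  ⟨L.integrable_comp hf.1, by rw [L.integral_comp_comm hf.1, hf.2]⟩

theorem congr (hf : HasMean ν f c) (h : ∀ x, f x = g x) (hcd : c = d) : HasMean ν g d := by
  subst hcd
  rwa [← (funext h : f = g)]

theorem const_mul {𝔸 : Type*} [NormedRing 𝔸] [NormedAlgebra ℝ 𝔸] [CompleteSpace 𝔸]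
    {f : E → 𝔸} {c : 𝔸} (hf : HasMean ν f c) (a : 𝔸) : HasMean ν (fun x => a * f x) (a * c) :=
  hf.map (ContinuousLinearMap.mul ℝ 𝔸 a)

theorem mul_const {𝔸 : Type*} [NormedRing 𝔸] [NormedAlgebra ℝ 𝔸] [CompleteSpace 𝔸]
    {f : E → 𝔸} {c : 𝔸} (hf : HasMean ν f c) (a : 𝔸) : HasMean ν (fun x => f x * a) (c * a) :=
  hf.map ((ContinuousLinearMap.mul ℝ 𝔸).flip a)

theorem le {f g : E → ℝ} {c d : ℝ} (hf : HasMean ν f c) (hg : HasMean ν g d)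
    (h : ∀ᵐ x ∂ν, f x ≤ g x) : c ≤ d := by
  rw [← hf.2, ← hg.2]
  exact integral_mono_ae hf.1 hg.1 h

end HasMean

/-- A continuous function of an essentially bounded variable is integrable. -/
theorem Continuous.integrable_comp_of_ae_bounded {E F G : Type*} [MeasurableSpace E]
    [NormedAddCommGroup F] [ProperSpace F] [NormedAddCommGroup G] {ν : Measure E}
    [IsFiniteMeasure ν] {g : F → G} (hg : Continuous g) {Y : E → F}
    (hY : AEStronglyMeasurable Y ν) {R : ℝ} (hR : ∀ᵐ x ∂ν, ‖Y x‖ ≤ R) :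
    Integrable (fun x => g (Y x)) ν := by
  obtain ⟨K, hK⟩ := (isCompact_closedBall (0 : F) R).exists_bound_of_continuousOn hg.continuousOn
  refine Integrable.of_bound (hg.comp_aestronglyMeasurable hY) K ?_
  filter_upwards [hR] with x hx
  exact hK _ (by simpa using hx)

variable {ι : Type*} [Fintype ι] [DecidableEq ι]

/-- The real part of the trace, as a continuous real-linear functional. -/
noncomputable def reTrace (ι : Type*) [Fintype ι] [DecidableEq ι] : Matrix ι ι ℂ →L[ℝ] ℝ :=
  LinearMap.toContinuousLinearMap
    (Complex.reLm ∘ₗ (Matrix.traceLinearMap ι ℂ ℂ).restrictScalars ℝ)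

@[simp]
theorem reTrace_apply (A : Matrix ι ι ℂ) : reTrace ι A = A.trace.re := rfl

theorem continuous_exp_smul_add (H : Matrix ι ι ℂ) (θ : ℝ) :
    Continuous fun A : Matrix ι ι ℂ => NormedSpace.exp (θ • (H + A)) := by
  let _ : NormedAlgebra ℚ (Matrix ι ι ℂ) := NormedAlgebra.restrictScalars ℚ ℂ _
  exact NormedSpace.exp_continuous.comp (by fun_prop)

/-- Replacing one summand `Y` of a random sum by its conditional second moment. -/
theorem integral_trace_mul_exp_le {E : Type*} [MeasurableSpace E] (ν : Measure E)
    [IsProbabilityMeasure ν] {Y : E → Matrix ι ι ℂ} (hYm : AEStronglyMeasurable Y ν)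
    (hY : ∀ y, (Y y).IsHermitian) (hY0 : ∫ y, Y y ∂ν = 0) {R : ℝ} (hR : 0 < R)
    (hYR : ∀ᵐ y ∂ν, ‖Y y‖ ≤ R) {H : Matrix ι ι ℂ} (hH : H.IsHermitian) {θ : ℝ} (hθ : 0 < θ)
    (hRθ : 3 / 4 * R * θ ≤ 1) :
    (1 - 3 / 4 * R * θ) *
        ∫ y, (Y y * NormedSpace.exp (θ • (H + Y y))).trace.re ∂ν ≤
      θ * ∫ y, ((∫ x, Y x * Y x ∂ν) * NormedSpace.exp (θ • (H + Y y))).trace.re ∂ν := by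
  set e : E → Matrix ι ι ℂ := fun y => NormedSpace.exp (θ • (H + Y y)) with he
  have hexp := continuous_exp_smul_add H θ
  have hmean : ∀ {G : Type _} [NormedAddCommGroup G] [NormedSpace ℝ G] {g : Matrix ι ι ℂ → G},
      Continuous g → HasMean ν (fun y => g (Y y)) (∫ y, g (Y y) ∂ν) := fun hg =>
    ⟨hg.integrable_comp_of_ae_bounded hYm hYR, rfl⟩
  have mY : HasMean ν Y 0 := ⟨(hmean continuous_id).1, hY0⟩
  have mV := hmean (g := fun A => A * A) (by fun_prop)
  have me := hmean hexp
  have mYe := hmean (g := fun A => A * NormedSpace.exp (θ • (H + A))) (continuous_id.mul hexp)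
  have mYYe := hmean (g := fun A => A * A * NormedSpace.exp (θ • (H + A)))
    ((continuous_id.mul continuous_id).mul hexp)
  -- In (P - Y)²e the term Y P e has P in the middle. Its mean is a linear map κ of P, which
  -- averages to κ 0 = 0 when P is replaced by a centred copy.
  have mK := hmean (g := fun A => ContinuousLinearMap.mulLeftRight ℝ (Matrix ι ι ℂ) A
      (NormedSpace.exp (θ • (H + A))))
    (((ContinuousLinearMap.mulLeftRight ℝ (Matrix ι ι ℂ)).continuous).clm_apply hexp)
  beta_reduce at mV me mYe mYYe mK
  set V := ∫ y, Y y * Y y ∂ν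
  change HasMean ν e _ at me
  change HasMean ν (fun y => Y y * e y) _ at mYe
  change HasMean ν (fun y => Y y * Y y * e y) _ at mYYe
  change HasMean ν (fun y => ContinuousLinearMap.mulLeftRight ℝ _ (Y y) (e y)) _ at mK
  set eb := ∫ y, NormedSpace.exp (θ • (H + Y y)) ∂ν
  set α := ∫ y, Y y * NormedSpace.exp (θ • (H + Y y)) ∂ν
  set β := ∫ y, Y y * Y y * NormedSpace.exp (θ • (H + Y y)) ∂ν
  set κ := ∫ y, ContinuousLinearMap.mulLeftRight ℝ (Matrix ι ι ℂ) (Y y)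
      (NormedSpace.exp (θ • (H + Y y))) ∂ν
  -- means over an independent copy, for a fixed value of the variable
  have in1 : ∀ P Q : Matrix ι ι ℂ,
      HasMean ν (fun y => (P - Y y) * (Q - e y)) (P * Q - P * eb + α) := fun P Q =>
    ((((HasMean.const (P * Q)).sub (me.const_mul P)).sub (mY.mul_const Q)).add mYe).congr
      (fun y => by noncomm_ring) (by simp)
  have in2 : ∀ P Q : Matrix ι ι ℂ,
      HasMean ν (fun y => (P - Y y) * (P - Y y) * (Q + e y))
        (P * P * Q + P * P * eb - P * α - κ P + V * Q + β) := fun P Q =>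
    ((((((((HasMean.const (P * P * Q)).add (me.const_mul (P * P))).sub (mYe.const_mul P)).sub
      (mK.map (ContinuousLinearMap.apply ℝ _ P))).add (mV.mul_const Q)).add mYYe).sub
      ((mY.const_mul P).mul_const Q)).sub (mY.mul_const (P * Q))).congr
      (fun y => by
        simp only [ContinuousLinearMap.apply_apply, ContinuousLinearMap.mulLeftRight_apply]
        noncomm_ring) (by simp)
  have in3 : ∀ P Q : Matrix ι ι ℂ,
      HasMean ν (fun y => (P * P - Y y * Y y) * (Q - e y))
        (P * P * Q - P * P * eb - V * Q + β) := fun P Q =>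
    ((((HasMean.const (P * P * Q)).sub (me.const_mul (P * P))).sub (mV.mul_const Q)).add
      mYYe).congr (fun y => by noncomm_ring) rfl
  have in4 : ∀ P Q : Matrix ι ι ℂ,
      HasMean ν (fun y => (P * P + Y y * Y y) * (Q + e y))
        (P * P * Q + P * P * eb + V * Q + β) := fun P Q =>
    ((((HasMean.const (P * P * Q)).add (me.const_mul (P * P))).add (mV.mul_const Q)).add
      mYYe).congr (fun y => by noncomm_ring) rfl
  -- means over both copies
  have out1 := ((mYe.sub (mY.mul_const eb)).add (HasMean.const (ν := ν) α)).map (reTrace ι)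
  have out2 := ((((((mYYe.add (mV.mul_const eb)).sub (mY.mul_const α)).sub (mY.map κ)).add
    (me.const_mul V)).add (HasMean.const (ν := ν) β))).map (reTrace ι)
  have out3 := (((mYYe.sub (mV.mul_const eb)).sub (me.const_mul V)).add
    (HasMean.const (ν := ν) β)).map (reTrace ι)
  have out4 := (((mYYe.add (mV.mul_const eb)).add (me.const_mul V)).add
    (HasMean.const (ν := ν) β)).map (reTrace ι)
  have ineq1 := out1.le (out2.const_mul (θ / 2)) <| Filter.Eventually.of_forall fun x =>
    ((in1 (Y x) (e x)).map (reTrace ι)).le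
      (((in2 (Y x) (e x)).map (reTrace ι)).const_mul (θ / 2)) <|
      Filter.Eventually.of_forall fun y => trace_sub_mul_exp_sub_exp_le hH (hY x) (hY y) hθ
  have ineq2 := out3.le ((out2.add (out4.const_mul 2)).const_mul (R * θ / 4)) <| by
    filter_upwards [hYR] with x hx
    refine ((in3 (Y x) (e x)).map (reTrace ι)).le
      ((((in2 (Y x) (e x)).map (reTrace ι)).add
        (((in4 (Y x) (e x)).map (reTrace ι)).const_mul 2)).const_mul (R * θ / 4)) ?_
    filter_upwards [hYR] with y hy
    refine (trace_sq_sub_sq_mul_exp_sub_exp_le hH (hY x) (hY y) hR hx hy hθ).trans (le_of_eq ?_)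
    simp only [Matrix.add_mul, Matrix.smul_mul, Matrix.trace_add, Matrix.trace_smul,
      Complex.add_re, Complex.smul_re, smul_eq_mul, reTrace_apply, he]
  have hα : ∫ y, (Y y * e y).trace.re ∂ν = reTrace ι α := (mYe.map (reTrace ι)).2
  have hγ : ∫ y, (V * e y).trace.re ∂ν = reTrace ι (V * eb) := ((me.const_mul V).map (reTrace ι)).2
  rw [hα, hγ]
  simp only [Matrix.zero_mul, map_zero, map_add, map_sub, sub_zero] at ineq1 ineq2
  -- Let c = 3/4 * R * θ and let a, b, g be the real traces of α, β, V * eb. The two inequalities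
  -- say 2a ≤ θ(b + g) and b - g ≤ c(b + g). Eliminating b leaves (1 - c)a ≤ θg.
  have h1 := mul_le_mul_of_nonneg_left ineq1 (sub_nonneg.2 hRθ)
  have h2 := mul_le_mul_of_nonneg_left ineq2 hθ.le
  linear_combination h1 / 2 + h2 / 4

end SingleSummand

/-! ### Hermitian dilation and its spectrum. -/

section Dilation

open Matrix
open scoped ComplexOrder MatrixOrder

variable {m n ι : Type*} [Fintype m] [Fintype n] [DecidableEq m] [DecidableEq n]
  [Fintype ι] [DecidableEq ι]

theorem Matrix.mem_spectrum_iff_exists_mulVec_eq {A : Matrix ι ι ℂ} {z : ℂ} :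
    z ∈ spectrum ℂ A ↔ ∃ v ≠ 0, A *ᵥ v = z • v := by
  rw [spectrum.mem_iff, Matrix.isUnit_iff_isUnit_det, isUnit_iff_ne_zero, not_not,
    ← Matrix.exists_mulVec_eq_zero_iff]
  refine exists_congr fun v => and_congr_right fun _ => ?_
  rw [Matrix.sub_mulVec, sub_eq_zero, Algebra.algebraMap_eq_smul_one, Matrix.smul_mulVec,
    Matrix.one_mulVec, eq_comm]

theorem Matrix.IsHermitian.trace_exp {A : Matrix ι ι ℂ} (hA : A.IsHermitian) :
    (NormedSpace.exp A).trace.re = ∑ i, Real.exp (hA.eigenvalues i) := by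
  obtain ⟨U, hU, -, -, h⟩ := hA.exists_diagonalization
  rw [h, Matrix.mul_assoc, trace_mul_comm, Matrix.mul_assoc, hU, Matrix.mul_one, trace_diagonal]
  simp only [Complex.re_sum, Complex.ofReal_re]

theorem Matrix.IsHermitian.exp_le_trace_exp {A : Matrix ι ι ℂ} (hA : A.IsHermitian) {x : ℝ}
    {v : ι → ℂ} (hv : v ≠ 0) (h : A *ᵥ v = (x : ℂ) • v) :
    Real.exp x ≤ (NormedSpace.exp A).trace.re := by
  have hx : x ∈ spectrum ℝ A := by
    rw [← spectrum.algebraMap_mem_iff ℂ]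
    exact mem_spectrum_iff_exists_mulVec_eq.2 ⟨v, hv, h⟩
  rw [hA.spectrum_real_eq_range_eigenvalues] at hx
  obtain ⟨i, rfl⟩ := hx
  rw [hA.trace_exp]
  exact Finset.single_le_sum (f := fun i => Real.exp (hA.eigenvalues i))
    (fun i _ => (Real.exp_pos _).le) (Finset.mem_univ i)

/-- The Hermitian dilation of a rectangular matrix. -/
noncomputable def hermitianDilation (m n : Type*) [Fintype m] [Fintype n] [DecidableEq m]
    [DecidableEq n] : Matrix m n ℂ →L[ℝ] Matrix (m ⊕ n) (m ⊕ n) ℂ :=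
  LinearMap.toContinuousLinearMap
    { toFun := fun Z => fromBlocks 0 Z Zᴴ 0
      map_add' := fun Z W => by simp [fromBlocks_add]
      map_smul' := fun c Z => by simp [fromBlocks_smul] }

/-- The block diagonal matrix with two given square blocks. -/
noncomputable def blockDiag₂ (m n : Type*) [Fintype m] [Fintype n] [DecidableEq m]
    [DecidableEq n] : Matrix m m ℂ × Matrix n n ℂ →L[ℝ] Matrix (m ⊕ n) (m ⊕ n) ℂ :=
  LinearMap.toContinuousLinearMap
    { toFun := fun P => fromBlocks P.1 0 0 P.2
      map_add' := fun Z W => by simp [fromBlocks_add]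
      map_smul' := fun c Z => by simp [fromBlocks_smul] }

theorem hermitianDilation_apply (Z : Matrix m n ℂ) :
    hermitianDilation m n Z = fromBlocks 0 Z Zᴴ 0 := rfl

theorem blockDiag₂_apply (P : Matrix m m ℂ × Matrix n n ℂ) :
    blockDiag₂ m n P = fromBlocks P.1 0 0 P.2 := rfl

theorem isHermitian_hermitianDilation (Z : Matrix m n ℂ) :
    (hermitianDilation m n Z).IsHermitian := by
  rw [hermitianDilation_apply, IsHermitian, fromBlocks_conjTranspose]
  simp

theorem hermitianDilation_mul_self (Z : Matrix m n ℂ) :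
    hermitianDilation m n Z * hermitianDilation m n Z = blockDiag₂ m n (Z * Zᴴ, Zᴴ * Z) := by
  simp [hermitianDilation_apply, blockDiag₂_apply, fromBlocks_multiply]

theorem posSemidef_blockDiag₂ {P : Matrix m m ℂ × Matrix n n ℂ} (h₁ : P.1.PosSemidef)
    (h₂ : P.2.PosSemidef) : (blockDiag₂ m n P).PosSemidef := by
  obtain ⟨S, hS⟩ := CStarAlgebra.nonneg_iff_eq_star_mul_self.1 (nonneg_iff_posSemidef.2 h₁)
  obtain ⟨T, hT⟩ := CStarAlgebra.nonneg_iff_eq_star_mul_self.1 (nonneg_iff_posSemidef.2 h₂)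
  have : blockDiag₂ m n P = (blockDiag₂ m n (S, T))ᴴ * blockDiag₂ m n (S, T) := by
    simp [blockDiag₂_apply, fromBlocks_multiply, fromBlocks_conjTranspose, hS, hT,
      star_eq_conjTranspose]
  rw [this]
  exact posSemidef_conjTranspose_mul_self _

theorem posSemidef_smul_one_sub_blockDiag₂ {P : Matrix m m ℂ × Matrix n n ℂ} {r : ℝ}
    (h₁ : P.1.IsHermitian) (h₂ : P.2.IsHermitian) (hr₁ : ‖P.1‖ ≤ r) (hr₂ : ‖P.2‖ ≤ r) :
    (r • (1 : Matrix (m ⊕ n) (m ⊕ n) ℂ) - blockDiag₂ m n P).PosSemidef := by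
  have h1 : (1 : Matrix (m ⊕ n) (m ⊕ n) ℂ) = blockDiag₂ m n (1, 1) := fromBlocks_one.symm
  rw [h1, ← map_smul, ← map_sub]
  exact posSemidef_blockDiag₂ (h₁.posSemidef_smul_one_sub hr₁) (h₂.posSemidef_smul_one_sub hr₂)

/-- The square of the dilation is block diagonal with blocks of norm at most ‖Z‖²; the C*-identity
then gives the bound. -/
theorem norm_hermitianDilation_le (Z : Matrix m n ℂ) : ‖hermitianDilation m n Z‖ ≤ ‖Z‖ := by
  have hZ : ‖Zᴴ * Z‖ ≤ ‖Z‖ * ‖Z‖ := (l2_opNorm_conjTranspose_mul_self Z).le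
  have hZ' : ‖Z * Zᴴ‖ ≤ ‖Z‖ * ‖Z‖ := by
    have := l2_opNorm_conjTranspose_mul_self Zᴴ
    rw [conjTranspose_conjTranspose, l2_opNorm_conjTranspose] at this
    exact this.le
  have hD := isHermitian_hermitianDilation Z
  have h := posSemidef_smul_one_sub_blockDiag₂ (P := (Z * Zᴴ, Zᴴ * Z))
    (isHermitian_mul_conjTranspose_self Z) (isHermitian_conjTranspose_mul_self Z) hZ' hZ
  rw [← hermitianDilation_mul_self, ← Matrix.le_iff, ← Algebra.algebraMap_eq_smul_one] at h
  have h0 : 0 ≤ hermitianDilation m n Z * hermitianDilation m n Z := by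
    have := posSemidef_self_mul_conjTranspose (hermitianDilation m n Z)
    rw [hD.eq] at this
    exact nonneg_iff_posSemidef.2 this
  have h2 := (CStarAlgebra.norm_le_iff_le_algebraMap _ (by positivity) h0).2 h
  have h3 : ‖hermitianDilation m n Z * hermitianDilation m n Z‖ =
      ‖hermitianDilation m n Z‖ * ‖hermitianDilation m n Z‖ := by
    simpa only [hD.eq] using l2_opNorm_conjTranspose_mul_self (hermitianDilation m n Z)
  rw [h3] at h2
  exact abs_le_of_sq_le_sq' (by nlinarith) (norm_nonneg Z) |>.2

/-- If v is an eigenvector of Z*Z for ‖Z‖², then (Zv, ‖Z‖v) is an eigenvector of the dilation for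
‖Z‖. For Z = 0 this vector vanishes, and the claim is that the trace of the identity is at least 1.
-/
theorem exp_mul_norm_le_trace_exp_hermitianDilation [Nonempty (m ⊕ n)] (Z : Matrix m n ℂ) (θ : ℝ) :
    Real.exp (θ * ‖Z‖) ≤ (NormedSpace.exp (θ • hermitianDilation m n Z)).trace.re := by
  rcases eq_or_ne Z 0 with rfl | hZ
  · simp only [map_zero, smul_zero, NormedSpace.exp_zero, norm_zero, mul_zero, Real.exp_zero,
      trace_one, Complex.natCast_re, Nat.one_le_cast]
    exact Fintype.card_pos
  · have hn : Nonempty n := by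
      by_contra h
      rw [not_nonempty_iff] at h
      exact hZ (Matrix.ext fun i j => h.elim j)
    have hpos : 0 < ‖Z‖ := norm_pos_iff.2 hZ
    have hspec : ‖Zᴴ * Z‖ ∈ spectrum ℝ (Zᴴ * Z) := CStarAlgebra.norm_mem_spectrum_of_nonneg
      (nonneg_iff_posSemidef.2 (posSemidef_conjTranspose_mul_self Z))
    rw [l2_opNorm_conjTranspose_mul_self, ← spectrum.algebraMap_mem_iff ℂ] at hspec
    obtain ⟨v, hv, hvZ⟩ := mem_spectrum_iff_exists_mulVec_eq.1 hspec
    refine ((isHermitian_hermitianDilation Z).smul (IsSelfAdjoint.all θ)).exp_le_trace_exp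
      (v := Sum.elim (Z *ᵥ v) ((‖Z‖ : ℂ) • v)) ?_ ?_
    · intro h
      apply hv
      funext j
      have := congrFun h (Sum.inr j)
      simpa [hpos.ne'] using this
    · rw [hermitianDilation_apply, smul_mulVec, fromBlocks_mulVec]
      ext (i | j)
      · simp [mulVec_smul, mul_assoc]
      · have := congrFun hvZ j
        simp only [mulVec_mulVec, Pi.smul_apply, Function.comp_def, Sum.elim_inl, Sum.elim_inr,
          zero_mulVec, add_zero, smul_eq_mul, Complex.real_smul, this]
        simp [mul_assoc]

end Dilation

/-! ### The trace moment generating function and its differential inequality. -/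

section TraceMGF

open Matrix
open scoped ComplexOrder

/-- Conditioning on S by Fubini: the joint law is a product, so W may be read at a second,
independent sample point ω'. -/
theorem ProbabilityTheory.IndepFun.integral_comp_eq_integral_integral {Ω E F : Type*}
    [MeasurableSpace Ω] {μ : Measure Ω} [IsProbabilityMeasure μ]
    [NormedAddCommGroup E] [MeasurableSpace E] [BorelSpace E] [ProperSpace E]
    [SecondCountableTopology E]
    [NormedAddCommGroup F] [MeasurableSpace F] [BorelSpace F] [ProperSpace F]
    [SecondCountableTopology F]
    {S : Ω → E} {W : Ω → F} (h : IndepFun S W μ) (hS : Measurable S) (hW : Measurable W)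
    {a b : ℝ} (hSa : ∀ᵐ ω ∂μ, ‖S ω‖ ≤ a) (hWb : ∀ᵐ ω ∂μ, ‖W ω‖ ≤ b)
    {φ : E × F → ℝ} (hφ : Continuous φ) :
    Integrable (fun ω => ∫ ω', φ (S ω, W ω') ∂μ) μ ∧
      ∫ ω, φ (S ω, W ω) ∂μ = ∫ ω, ∫ ω', φ (S ω, W ω') ∂μ ∂μ := by
  have hm : Measurable (Prod.map S W) := hS.prodMap hW
  have hint : Integrable (fun p => φ (Prod.map S W p)) (μ.prod μ) := by
    refine hφ.integrable_comp_of_ae_bounded hm.aestronglyMeasurable (R := max a b) ?_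
    filter_upwards [Measure.quasiMeasurePreserving_fst.ae hSa,
      Measure.quasiMeasurePreserving_snd.ae hWb] with p h1 h2
    exact max_le_max h1 h2
  refine ⟨hint.integral_prod_left, ?_⟩
  have hlaw : μ.map (fun ω => (S ω, W ω)) = (μ.prod μ).map (Prod.map S W) := by
    rw [(indepFun_iff_map_prod_eq_prod_map_map hS.aemeasurable hW.aemeasurable).1 h,
      Measure.map_prod_map μ μ hS hW]
  have e1 := integral_map (μ := μ) (hS.prodMk hW).aemeasurable
    (f := φ) hφ.aestronglyMeasurable
  have e2 := integral_map (μ := μ.prod μ) hm.aemeasurable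
    (f := φ) hφ.aestronglyMeasurable
  rw [← e1, hlaw, e2, integral_prod _ hint]
  rfl

variable {ι : Type*} [Fintype ι] [DecidableEq ι]

theorem hasDerivAt_integral_trace_exp {Ω : Type*} [MeasurableSpace Ω] {μ : Measure Ω}
    [IsProbabilityMeasure μ] {X : Ω → Matrix ι ι ℂ} (hX : AEStronglyMeasurable X μ) {K : ℝ}
    (hK : ∀ᵐ ω ∂μ, ‖X ω‖ ≤ K) (θ : ℝ) :
    HasDerivAt (fun s : ℝ => ∫ ω, (NormedSpace.exp (s • X ω)).trace.re ∂μ)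
      (∫ ω, (X ω * NormedSpace.exp (θ • X ω)).trace.re ∂μ) θ := by
  let _ : NormedAlgebra ℚ (Matrix ι ι ℂ) := NormedAlgebra.restrictScalars ℚ ℂ _
  have hjoint : Continuous fun p : ℝ × Matrix ι ι ℂ => p.2 * NormedSpace.exp (p.1 • p.2) :=
    continuous_snd.mul (NormedSpace.exp_continuous.comp (by fun_prop))
  obtain ⟨B, hB⟩ := ((isCompact_closedBall θ 1).prod
    (isCompact_closedBall (0 : Matrix ι ι ℂ) K)).exists_bound_of_continuousOn
    ((reTrace ι).continuous.comp hjoint).continuousOn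
  have hc : ∀ s : ℝ, Continuous fun A : Matrix ι ι ℂ => NormedSpace.exp (s • A) := fun s =>
    NormedSpace.exp_continuous.comp (by fun_prop)
  refine (hasDerivAt_integral_of_dominated_loc_of_deriv_le (bound := fun _ => B)
    (F := fun s ω => (NormedSpace.exp (s • X ω)).trace.re)
    (F' := fun s ω => (X ω * NormedSpace.exp (s • X ω)).trace.re)
    (Metric.closedBall_mem_nhds θ one_pos) (Filter.Eventually.of_forall fun s => ?_) ?_ ?_ ?_
    (integrable_const B) ?_).2
  · exact ((reTrace ι).continuous.comp (hc s)).comp_aestronglyMeasurable hX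
  · exact ((reTrace ι).continuous.comp (hc θ)).integrable_comp_of_ae_bounded hX hK
  · exact ((reTrace ι).continuous.comp
      (continuous_id.mul (hc θ))).comp_aestronglyMeasurable hX
  · filter_upwards [hK] with ω hω s hs
    exact hB (s, X ω) ⟨hs, by simpa using hω⟩
  · refine Filter.Eventually.of_forall fun ω s _ => ?_
    have h := (reTrace ι).hasFDerivAt.comp_hasDerivAt s
      (hasDerivAt_exp_smul_const' (𝕂 := ℝ) (X ω) s)
    exact h

variable {Ω : Type*} [MeasurableSpace Ω] {μ : Measure Ω} {d₁ d₂ n : ℕ}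
  {Z : Fin n → Ω → Matrix (Fin d₁) (Fin d₂) ℂ} {R : ℝ}

theorem ae_norm_sum_le {E κ : Type*} [NormedAddCommGroup E] {Z : κ → Ω → E}
    {s : Finset κ} (h : ∀ k ∈ s, ∀ᵐ ω ∂μ, ‖Z k ω‖ ≤ R) :
    ∀ᵐ ω ∂μ, ‖∑ k ∈ s, Z k ω‖ ≤ s.card • R := by
  have : ∀ᵐ ω ∂μ, ∀ k ∈ s, ‖Z k ω‖ ≤ R := (Finset.eventually_all s).2 h
  filter_upwards [this] with ω hω
  exact (norm_sum_le _ _).trans (Finset.sum_le_card_nsmul _ _ _ hω)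

/-- The sum S of the other summands is independent of Z k. Its dilation is the fixed matrix H of the
one-summand estimate, which is then averaged over S. -/
theorem integral_trace_dilation_mul_exp_le [IsProbabilityMeasure μ] (hmeas : ∀ k, Measurable (Z k))
    (hindep : iIndepFun Z μ) (hmean : ∀ k, ∫ ω, Z k ω ∂μ = 0) (hR : 0 < R)
    (hbound : ∀ k, ∀ᵐ ω ∂μ, ‖Z k ω‖ ≤ R) (k : Fin n) {θ : ℝ} (hθ : 0 < θ)
    (hRθ : 3 / 4 * R * θ ≤ 1) :
    (1 - 3 / 4 * R * θ) * ∫ ω, (hermitianDilation (Fin d₁) (Fin d₂) (Z k ω) *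
        NormedSpace.exp (θ • hermitianDilation (Fin d₁) (Fin d₂) (∑ j, Z j ω))).trace.re ∂μ ≤
      θ * ∫ ω, ((∫ x, hermitianDilation (Fin d₁) (Fin d₂) (Z k x) *
        hermitianDilation (Fin d₁) (Fin d₂) (Z k x) ∂μ) *
        NormedSpace.exp (θ • hermitianDilation (Fin d₁) (Fin d₂) (∑ j, Z j ω))).trace.re ∂μ := by
  let _ : NormedAlgebra ℚ (Matrix (Fin d₁ ⊕ Fin d₂) (Fin d₁ ⊕ Fin d₂) ℂ) :=
    NormedAlgebra.restrictScalars ℚ ℂ _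
  set D := hermitianDilation (Fin d₁) (Fin d₂)
  set S : Ω → Matrix (Fin d₁) (Fin d₂) ℂ := ∑ j ∈ Finset.univ.erase k, Z j with hS
  have hSW : IndepFun S (Z k) μ :=
    hindep.indepFun_finsetSum_of_notMem hmeas (Finset.notMem_erase k _)
  have hSm : Measurable S := by
    rw [hS, Finset.sum_fn]
    exact Finset.measurable_sum _ fun j _ => hmeas j
  have hSb : ∀ᵐ ω ∂μ, ‖S ω‖ ≤ (Finset.univ.erase k).card • R := by
    simpa only [hS, Finset.sum_apply] using ae_norm_sum_le fun j _ => hbound j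
  have hsum : ∀ ω, D (∑ j, Z j ω) = D (S ω) + D (Z k ω) := fun ω => by
    rw [hS, Finset.sum_apply, ← map_add, Finset.sum_erase_add _ _ (Finset.mem_univ k)]
  simp only [hsum]
  have hE : Continuous fun p : Matrix (Fin d₁) (Fin d₂) ℂ × Matrix (Fin d₁) (Fin d₂) ℂ =>
      NormedSpace.exp (θ • (D p.1 + D p.2)) := NormedSpace.exp_continuous.comp (by fun_prop)
  set V := ∫ x, D (Z k x) * D (Z k x) ∂μ
  obtain ⟨i1, e1⟩ := hSW.integral_comp_eq_integral_integral hSm (hmeas k) hSb (hbound k)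
    (φ := fun p => (D p.2 * NormedSpace.exp (θ • (D p.1 + D p.2))).trace.re)
    ((reTrace _).continuous.comp ((D.continuous.comp continuous_snd).mul hE))
  obtain ⟨i2, e2⟩ := hSW.integral_comp_eq_integral_integral hSm (hmeas k) hSb (hbound k)
    (φ := fun p => (V * NormedSpace.exp (θ • (D p.1 + D p.2))).trace.re)
    ((reTrace _).continuous.comp (continuous_const.mul hE))
  rw [e1, e2, ← integral_const_mul, ← integral_const_mul]
  refine integral_mono (i1.const_mul _) (i2.const_mul _) fun ω => ?_
  refine integral_trace_mul_exp_le μ (Y := fun x => D (Z k x))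
    (D.continuous.comp_aestronglyMeasurable (hmeas k).aestronglyMeasurable)
    (fun x => isHermitian_hermitianDilation _) ?_ hR ?_ (isHermitian_hermitianDilation _) hθ hRθ
  · have hi : Integrable (Z k) μ := continuous_id.integrable_comp_of_ae_bounded
      (hmeas k).aestronglyMeasurable (hbound k)
    rw [D.integral_comp_comm hi, hmean, map_zero]
  · filter_upwards [hbound k] with x hx
    exact (norm_hermitianDilation_le _).trans hx

theorem isHermitian_integral {Y : Ω → Matrix ι ι ℂ} (hY : ∀ ω, (Y ω).IsHermitian) :
    (∫ ω, Y ω ∂μ).IsHermitian := by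
  have h := ((starL' ℝ : Matrix ι ι ℂ ≃L[ℝ] Matrix ι ι ℂ)).integral_comp_comm (μ := μ) Y
  have e : (fun ω => (starL' ℝ : Matrix ι ι ℂ ≃L[ℝ] Matrix ι ι ℂ) (Y ω)) = Y :=
    funext fun ω => hY ω
  rw [e] at h
  exact h.symm

/-- The squares of the dilations are block diagonal, and the two blocks of the sum are the two
matrices in the maximum defining σ². -/
theorem posSemidef_variance_sub_sum_sq [IsProbabilityMeasure μ] (hmeas : ∀ k, Measurable (Z k))
    (hbound : ∀ k, ∀ᵐ ω ∂μ, ‖Z k ω‖ ≤ R) :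
    (matrixVariance μ Z • (1 : Matrix (Fin d₁ ⊕ Fin d₂) (Fin d₁ ⊕ Fin d₂) ℂ) -
      ∑ k, ∫ x, hermitianDilation (Fin d₁) (Fin d₂) (Z k x) *
        hermitianDilation (Fin d₁) (Fin d₂) (Z k x) ∂μ).PosSemidef := by
  have hV : ∀ k, ∫ x, hermitianDilation (Fin d₁) (Fin d₂) (Z k x) *
        hermitianDilation (Fin d₁) (Fin d₂) (Z k x) ∂μ =
      blockDiag₂ _ _ (∫ ω, Z k ω * (Z k ω)ᴴ ∂μ, ∫ ω, (Z k ω)ᴴ * Z k ω ∂μ) := by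
    intro k
    have c1 : Continuous fun A : Matrix (Fin d₁) (Fin d₂) ℂ => A * Aᴴ := by fun_prop
    have c2 : Continuous fun A : Matrix (Fin d₁) (Fin d₂) ℂ => Aᴴ * A := by fun_prop
    have i1 := c1.integrable_comp_of_ae_bounded (hmeas k).aestronglyMeasurable (hbound k)
    have i2 := c2.integrable_comp_of_ae_bounded (hmeas k).aestronglyMeasurable (hbound k)
    simp only [hermitianDilation_mul_self]
    rw [ContinuousLinearMap.integral_comp_comm _ (i1.prodMk i2), integral_pair i1 i2]
  simp only [hV]
  rw [← map_sum]
  refine posSemidef_smul_one_sub_blockDiag₂ ?_ ?_ ?_ ?_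
  · rw [Prod.fst_sum]
    exact isSelfAdjoint_sum _ fun k _ =>
      isHermitian_integral fun ω => isHermitian_mul_conjTranspose_self _
  · rw [Prod.snd_sum]
    exact isSelfAdjoint_sum _ fun k _ =>
      isHermitian_integral fun ω => isHermitian_conjTranspose_mul_self _
  · rw [Prod.fst_sum]
    exact le_max_left _ _
  · rw [Prod.snd_sum]
    exact le_max_right _ _

theorem matrixVariance_nonneg : 0 ≤ matrixVariance μ Z :=
  (norm_nonneg _).trans (le_max_left _ _)

theorem integral_trace_mul_exp_dilation_le [IsProbabilityMeasure μ] (hmeas : ∀ k, Measurable (Z k))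
    (hindep : iIndepFun Z μ) (hmean : ∀ k, ∫ ω, Z k ω ∂μ = 0) (hR : 0 < R)
    (hbound : ∀ k, ∀ᵐ ω ∂μ, ‖Z k ω‖ ≤ R) {θ : ℝ} (hθ : 0 < θ) (hRθ : 3 / 4 * R * θ ≤ 1) :
    (1 - 3 / 4 * R * θ) * ∫ ω, (hermitianDilation (Fin d₁) (Fin d₂) (∑ j, Z j ω) *
        NormedSpace.exp (θ • hermitianDilation (Fin d₁) (Fin d₂) (∑ j, Z j ω))).trace.re ∂μ ≤
      θ * (matrixVariance μ Z * ∫ ω, (NormedSpace.exp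
        (θ • hermitianDilation (Fin d₁) (Fin d₂) (∑ j, Z j ω))).trace.re ∂μ) := by
  let _ : NormedAlgebra ℚ (Matrix (Fin d₁ ⊕ Fin d₂) (Fin d₁ ⊕ Fin d₂) ℂ) :=
    NormedAlgebra.restrictScalars ℚ ℂ _
  set D := hermitianDilation (Fin d₁) (Fin d₂)
  have hZm : AEStronglyMeasurable (fun ω => ∑ j, Z j ω) μ :=
    (Finset.measurable_sum _ fun j _ => hmeas j).aestronglyMeasurable
  have hZb : ∀ᵐ ω ∂μ, ‖∑ j, Z j ω‖ ≤ (Finset.univ : Finset (Fin n)).card • R :=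
    ae_norm_sum_le fun j _ => hbound j
  have hexp : Continuous fun A : Matrix (Fin d₁) (Fin d₂) ℂ => NormedSpace.exp (θ • D A) :=
    NormedSpace.exp_continuous.comp (by fun_prop)
  have hint : ∀ P : Matrix (Fin d₁ ⊕ Fin d₂) (Fin d₁ ⊕ Fin d₂) ℂ,
      Integrable (fun ω => (P * NormedSpace.exp (θ • D (∑ j, Z j ω))).trace.re) μ := fun P =>
    ((reTrace _).continuous.comp
      (continuous_const.mul hexp)).integrable_comp_of_ae_bounded hZm hZb
  have hint' : ∀ k, Integrable
      (fun ω => (D (Z k ω) * NormedSpace.exp (θ • D (∑ j, Z j ω))).trace.re) μ := by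
    intro k
    have hc : Continuous fun p : Matrix (Fin d₁) (Fin d₂) ℂ × Matrix (Fin d₁) (Fin d₂) ℂ =>
        (D p.1 * NormedSpace.exp (θ • D p.2)).trace.re :=
      (reTrace _).continuous.comp
        ((D.continuous.comp continuous_fst).mul (hexp.comp continuous_snd))
    have hb : ∀ᵐ ω ∂μ, ‖(Z k ω, ∑ j, Z j ω)‖ ≤
        max R ((Finset.univ : Finset (Fin n)).card • R) := by
      filter_upwards [hbound k, hZb] with ω h1 h2
      exact max_le_max h1 h2
    exact hc.integrable_comp_of_ae_bounded (Y := fun ω => (Z k ω, ∑ j, Z j ω))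
      ((hmeas k).aestronglyMeasurable.prodMk hZm) hb
  have e1 : ∫ ω, (D (∑ j, Z j ω) * NormedSpace.exp (θ • D (∑ j, Z j ω))).trace.re ∂μ =
      ∑ k, ∫ ω, (D (Z k ω) * NormedSpace.exp (θ • D (∑ j, Z j ω))).trace.re ∂μ := by
    rw [← integral_finsetSum _ fun k _ => hint' k]
    refine integral_congr_ae (Filter.Eventually.of_forall fun ω => ?_)
    beta_reduce
    generalize NormedSpace.exp (θ • D (∑ j, Z j ω)) = Q
    rw [map_sum, Finset.sum_mul, trace_sum, Complex.re_sum]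
  rw [e1, Finset.mul_sum]
  refine (Finset.sum_le_sum fun k _ => integral_trace_dilation_mul_exp_le hmeas hindep hmean hR
    hbound k hθ hRθ).trans ?_
  rw [← Finset.mul_sum, ← integral_finsetSum _ fun k _ => hint _]
  refine mul_le_mul_of_nonneg_left ?_ hθ.le
  rw [← integral_const_mul]
  have hone := hint (matrixVariance μ Z • 1)
  simp only [smul_mul_assoc, Matrix.one_mul, trace_smul, Complex.smul_re, smul_eq_mul] at hone
  refine integral_mono (integrable_finsetSum _ fun k _ => hint _) hone fun ω => ?_
  have h := trace_mul_le_trace_mul (posSemidef_variance_sub_sum_sq hmeas hbound)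
    ((isHermitian_hermitianDilation (∑ j, Z j ω)).smul (IsSelfAdjoint.all θ)).posSemidef_exp
  simpa only [smul_mul_assoc, Matrix.one_mul, trace_smul, Complex.smul_re, smul_eq_mul,
    Finset.sum_mul, trace_sum, Complex.re_sum] using h

/-- A Grönwall argument: with 1 - cs replaced by its least value q on [0, θ], the function M(s)
exp(-vs²/(2q)) is nonincreasing. -/
theorem le_mul_exp_of_hasDerivAt_of_le {M M' : ℝ → ℝ} (hder : ∀ s, HasDerivAt M (M' s) s)
    (hM0 : ∀ s, 0 ≤ M s) {c v : ℝ} (hc : 0 ≤ c) (hv : 0 ≤ v)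
    (hbd : ∀ s, 0 < s → c * s ≤ 1 → (1 - c * s) * M' s ≤ s * (v * M s))
    {θ : ℝ} (hθ : 0 ≤ θ) (hcθ : c * θ < 1) :
    M θ ≤ M 0 * Real.exp (v * θ ^ 2 / (2 * (1 - c * θ))) := by
  set q := 1 - c * θ with hq
  have hq0 : 0 < q := sub_pos.2 hcθ
  have hg : ∀ s : ℝ, HasDerivAt (fun s => M s * Real.exp (-(v / (2 * q)) * s ^ 2))
      (M' s * Real.exp (-(v / (2 * q)) * s ^ 2) +
        M s * (Real.exp (-(v / (2 * q)) * s ^ 2) * (-(v / (2 * q)) * (2 * s)))) s := by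
    intro s
    refine (hder s).mul ?_
    have := ((hasDerivAt_pow 2 s).const_mul (-(v / (2 * q)))).exp
    simpa using this
  have hanti := antitoneOn_of_deriv_nonpos (convex_Icc 0 θ)
    (f := fun s => M s * Real.exp (-(v / (2 * q)) * s ^ 2))
    (fun s _ => (hg s).continuousAt.continuousWithinAt)
    (fun s _ => (hg s).differentiableAt.differentiableWithinAt)
    (fun s hs => by
      rw [interior_Icc] at hs
      rw [(hg s).deriv]
      have hqs : q ≤ 1 - c * s := by
        rw [hq]
        nlinarith [hs.1, hs.2]
      have h1 := hbd s hs.1 (by linarith)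
      have h2 : M' s ≤ v / q * s * M s := by
        have hr : 0 ≤ s * (v * M s) := mul_nonneg hs.1.le (mul_nonneg hv (hM0 s))
        have h3 : M' s ≤ s * (v * M s) / (1 - c * s) := by
          rw [le_div_iff₀ (hq0.trans_le hqs)]
          linarith
        refine h3.trans ((div_le_div_of_nonneg_left hr hq0 hqs).trans (le_of_eq ?_))
        ring
      have h5 := mul_nonpos_of_nonpos_of_nonneg (sub_nonpos.2 h2)
        (Real.exp_pos (-(v / (2 * q)) * s ^ 2)).le
      refine le_trans (le_of_eq ?_) h5
      field_simp
      ring)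
  have h := hanti ⟨le_rfl, hθ⟩ ⟨hθ, le_rfl⟩ hθ
  simp only [ne_eq, OfNat.ofNat_ne_zero, not_false_eq_true, zero_pow, mul_zero,
    Real.exp_zero, mul_one] at h
  have h6 : M θ = M θ * Real.exp (-(v / (2 * q)) * θ ^ 2) * Real.exp (v * θ ^ 2 / (2 * q)) := by
    rw [mul_assoc, ← Real.exp_add]
    have : -(v / (2 * q)) * θ ^ 2 + v * θ ^ 2 / (2 * q) = 0 := by ring
    rw [this, Real.exp_zero, mul_one]
  rw [h6]
  exact mul_le_mul_of_nonneg_right h (Real.exp_pos _).le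

/-- The trace moment generating function bound of Bernstein type. -/
theorem integral_trace_exp_dilation_le [IsProbabilityMeasure μ] (hmeas : ∀ k, Measurable (Z k))
    (hindep : iIndepFun Z μ) (hmean : ∀ k, ∫ ω, Z k ω ∂μ = 0) (hR : 0 < R)
    (hbound : ∀ k, ∀ᵐ ω ∂μ, ‖Z k ω‖ ≤ R) {θ : ℝ} (hθ : 0 ≤ θ) (hRθ : 3 / 4 * R * θ < 1) :
    ∫ ω, (NormedSpace.exp
        (θ • hermitianDilation (Fin d₁) (Fin d₂) (∑ j, Z j ω))).trace.re ∂μ ≤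
      ((d₁ + d₂ : ℕ) : ℝ) *
        Real.exp (matrixVariance μ Z * θ ^ 2 / (2 * (1 - 3 / 4 * R * θ))) := by
  have hXm : AEStronglyMeasurable
      (fun ω => hermitianDilation (Fin d₁) (Fin d₂) (∑ j, Z j ω)) μ :=
    (hermitianDilation (Fin d₁) (Fin d₂)).continuous.comp_aestronglyMeasurable
      (Finset.measurable_sum _ fun j _ => hmeas j).aestronglyMeasurable
  have hXb : ∀ᵐ ω ∂μ, ‖hermitianDilation (Fin d₁) (Fin d₂) (∑ j, Z j ω)‖ ≤
      (Finset.univ : Finset (Fin n)).card • R := by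
    filter_upwards [ae_norm_sum_le (s := Finset.univ) fun j _ => hbound j] with ω hω
    exact (norm_hermitianDilation_le _).trans hω
  have h := le_mul_exp_of_hasDerivAt_of_le (fun s => hasDerivAt_integral_trace_exp hXm hXb s)
    (fun s => integral_nonneg fun ω => by
      rw [Pi.zero_apply,
        ((isHermitian_hermitianDilation (∑ j, Z j ω)).smul (IsSelfAdjoint.all s)).trace_exp]
      positivity)
    (by positivity) (matrixVariance_nonneg (μ := μ) (Z := Z))
    (fun s hs hRs => integral_trace_mul_exp_dilation_le hmeas hindep hmean hR hbound hs hRs) hθ hRθ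
  refine h.trans (le_of_eq ?_)
  simp [NormedSpace.exp_zero, trace_one]

end TraceMGF

/-! ### Tail and mean of the norm. -/

section NormBounds

variable {Ω : Type*} [MeasurableSpace Ω] {μ : Measure Ω} [IsProbabilityMeasure μ] {d₁ d₂ n : ℕ}
  {Z : Fin n → Ω → Matrix (Fin d₁) (Fin d₂) ℂ} {R : ℝ}

theorem integrable_exp_mul_norm_sum (hmeas : ∀ k, Measurable (Z k))
    (hbound : ∀ k, ∀ᵐ ω ∂μ, ‖Z k ω‖ ≤ R) (θ : ℝ) :
    Integrable (fun ω => Real.exp (θ * ‖∑ k, Z k ω‖)) μ := by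
  have hc : Continuous fun A : Matrix (Fin d₁) (Fin d₂) ℂ => Real.exp (θ * ‖A‖) := by fun_prop
  exact hc.integrable_comp_of_ae_bounded
    (Finset.measurable_sum _ fun j _ => hmeas j).aestronglyMeasurable
    (ae_norm_sum_le (s := Finset.univ) fun j _ => hbound j)

theorem integrable_norm_sum (hmeas : ∀ k, Measurable (Z k))
    (hbound : ∀ k, ∀ᵐ ω ∂μ, ‖Z k ω‖ ≤ R) : Integrable (fun ω => ‖∑ k, Z k ω‖) μ :=
  continuous_norm.integrable_comp_of_ae_bounded
    (Finset.measurable_sum _ fun j _ => hmeas j).aestronglyMeasurable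
    (ae_norm_sum_le (s := Finset.univ) fun j _ => hbound j)

theorem mgf_norm_sum_le (hd : 0 < d₁ + d₂) (hmeas : ∀ k, Measurable (Z k))
    (hindep : iIndepFun Z μ) (hmean : ∀ k, ∫ ω, Z k ω ∂μ = 0) (hR : 0 < R)
    (hbound : ∀ k, ∀ᵐ ω ∂μ, ‖Z k ω‖ ≤ R) {θ : ℝ} (hθ : 0 ≤ θ) (hRθ : 3 / 4 * R * θ < 1) :
    mgf (fun ω => ‖∑ k, Z k ω‖) μ θ ≤ ((d₁ + d₂ : ℕ) : ℝ) *
        Real.exp (matrixVariance μ Z * θ ^ 2 / (2 * (1 - 3 / 4 * R * θ))) := by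
  refine le_trans ?_ (integral_trace_exp_dilation_le hmeas hindep hmean hR hbound hθ hRθ)
  have : Nonempty (Fin d₁ ⊕ Fin d₂) := by
    rw [← Fintype.card_pos_iff]
    simpa using hd
  have hc : Continuous fun A : Matrix (Fin d₁) (Fin d₂) ℂ =>
      (NormedSpace.exp (θ • hermitianDilation (Fin d₁) (Fin d₂) A)).trace.re := by
    let _ : NormedAlgebra ℚ (Matrix (Fin d₁ ⊕ Fin d₂) (Fin d₁ ⊕ Fin d₂) ℂ) :=
      NormedAlgebra.restrictScalars ℚ ℂ _
    exact (reTrace _).continuous.comp (NormedSpace.exp_continuous.comp (by fun_prop))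
  refine integral_mono (integrable_exp_mul_norm_sum hmeas hbound θ)
    (hc.integrable_comp_of_ae_bounded
      (Finset.measurable_sum _ fun j _ => hmeas j).aestronglyMeasurable
      (ae_norm_sum_le (s := Finset.univ) fun j _ => hbound j))
    fun ω => exp_mul_norm_le_trace_exp_hermitianDilation _ _

theorem measureReal_norm_sum_ge_le (hd : 0 < d₁ + d₂) (hmeas : ∀ k, Measurable (Z k))
    (hindep : iIndepFun Z μ) (hmean : ∀ k, ∫ ω, Z k ω ∂μ = 0) (hR : 0 < R)
    (hbound : ∀ k, ∀ᵐ ω ∂μ, ‖Z k ω‖ ≤ R) {t : ℝ} (ht : 0 < t) :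
    μ.real {ω | t ≤ ‖∑ k, Z k ω‖} ≤ ((d₁ + d₂ : ℕ) : ℝ) *
      Real.exp (-t ^ 2 / (3 * matrixVariance μ Z + 2 * R * t)) := by
  have hv : 0 ≤ matrixVariance μ Z := matrixVariance_nonneg
  set v := matrixVariance μ Z with hv'
  have hRt : 0 < R * t := mul_pos hR ht
  set q := 3 * v + 2 * R * t with hq
  have hq0 : 0 < q := by linarith
  -- The Markov parameter is θ = 2t/q. Then θt = 2t²/q, while the exponent of the moment generating
  -- function bound is at most t²/q.
  have hθ : 0 ≤ 2 * t / q := by positivity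
  have e1 : 1 - 3 / 4 * R * (2 * t / q) = (3 * v + R * t / 2) / q := by
    field_simp
    rw [hq]
    ring
  have hpos : 0 < 3 * v + R * t / 2 := by linarith
  have hRθ : 3 / 4 * R * (2 * t / q) < 1 := by
    rw [← sub_pos, e1]
    positivity
  have h := measure_ge_le_exp_mul_mgf (μ := μ) (X := fun ω => ‖∑ k, Z k ω‖) t hθ
    (integrable_exp_mul_norm_sum hmeas hbound _)
  refine h.trans ((mul_le_mul_of_nonneg_left
    (mgf_norm_sum_le hd hmeas hindep hmean hR hbound hθ hRθ) (Real.exp_pos _).le).trans ?_)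
  rw [mul_left_comm, ← Real.exp_add]
  refine mul_le_mul_of_nonneg_left (Real.exp_le_exp.2 ?_) (Nat.cast_nonneg _)
  rw [e1, ← hv']
  have e2 : v * (2 * t / q) ^ 2 / (2 * ((3 * v + R * t / 2) / q)) =
      t ^ 2 / q * (2 * v / (3 * v + R * t / 2)) := by
    field_simp
  have h3 : 2 * v / (3 * v + R * t / 2) ≤ 1 := by
    rw [div_le_one hpos]
    linarith
  have h4 : t ^ 2 / q * (2 * v / (3 * v + R * t / 2)) ≤ t ^ 2 / q * 1 :=
    mul_le_mul_of_nonneg_left h3 (by positivity)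
  rw [e2]
  have e3 : -(2 * t / q) * t = -(2 * (t ^ 2 / q)) := by ring
  rw [e3, neg_div]
  linarith

/-- Jensen's inequality at θ = 1/(u + 3R/4), parametrized so that 1 - 3Rθ/4 = uθ. The variable u is
left free for optimization. -/
theorem integral_norm_sum_le_add (hd : 0 < d₁ + d₂) (hmeas : ∀ k, Measurable (Z k))
    (hindep : iIndepFun Z μ) (hmean : ∀ k, ∫ ω, Z k ω ∂μ = 0) (hR : 0 < R)
    (hbound : ∀ k, ∀ᵐ ω ∂μ, ‖Z k ω‖ ≤ R) {u : ℝ} (hu : 0 < u) :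
    ∫ ω, ‖∑ k, Z k ω‖ ∂μ ≤ Real.log ((d₁ + d₂ : ℕ) : ℝ) * (u + 3 / 4 * R) +
      matrixVariance μ Z / (2 * u) := by
  set w := u + 3 / 4 * R with hw
  have hw0 : 0 < w := by positivity
  have e1 : 1 - 3 / 4 * R * w⁻¹ = u / w := by
    field_simp
    rw [hw]
    ring
  have hRθ : 3 / 4 * R * w⁻¹ < 1 := by
    rw [← sub_pos, e1]
    positivity
  have h1 := mgf_norm_sum_le hd hmeas hindep hmean hR hbound (inv_nonneg.2 hw0.le) hRθ
  have h2 : Real.exp (∫ ω, w⁻¹ * ‖∑ k, Z k ω‖ ∂μ) ≤ mgf (fun ω => ‖∑ k, Z k ω‖) μ w⁻¹ :=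
    convexOn_exp.map_integral_le Real.continuous_exp.continuousOn isClosed_univ
      (Filter.Eventually.of_forall fun _ => Set.mem_univ _)
      ((integrable_norm_sum hmeas hbound).const_mul _)
      (integrable_exp_mul_norm_sum hmeas hbound _)
  have hd' : (0 : ℝ) < ((d₁ + d₂ : ℕ) : ℝ) := Nat.cast_pos.2 hd
  rw [integral_const_mul] at h2
  have h3 := h2.trans h1
  rw [← Real.exp_log hd', ← Real.exp_add, Real.exp_le_exp, e1] at h3
  have h4 := mul_le_mul_of_nonneg_left h3 hw0.le
  rw [mul_inv_cancel_left₀ hw0.ne'] at h4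
  refine h4.trans (le_of_eq ?_)
  field_simp

theorem integral_norm_sum_le (hd : 0 < d₁ + d₂) (hmeas : ∀ k, Measurable (Z k))
    (hindep : iIndepFun Z μ) (hmean : ∀ k, ∫ ω, Z k ω ∂μ = 0) (hR : 0 < R)
    (hbound : ∀ k, ∀ᵐ ω ∂μ, ‖Z k ω‖ ≤ R) :
    ∫ ω, ‖∑ k, Z k ω‖ ∂μ ≤
      Real.sqrt (matrixVariance μ Z) * Real.sqrt (3 * Real.log ((d₁ + d₂ : ℕ) : ℝ)) +
        R * Real.log ((d₁ + d₂ : ℕ) : ℝ) := by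
  have h := fun u hu => integral_norm_sum_le_add (u := u) hd hmeas hindep hmean hR hbound hu
  have hv : 0 ≤ matrixVariance μ Z := matrixVariance_nonneg
  have hL : 0 ≤ Real.log ((d₁ + d₂ : ℕ) : ℝ) := Real.log_natCast_nonneg _
  generalize matrixVariance μ Z = v at *
  generalize Real.log ((d₁ + d₂ : ℕ) : ℝ) = L at *
  generalize ∫ ω, ‖∑ k, Z k ω‖ ∂μ = E at *
  rcases hL.eq_or_lt with rfl | hL
  · simp only [zero_mul, zero_add, mul_zero, Real.sqrt_zero, add_zero] at h ⊢
    by_contra! hE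
    -- When log d = 0 the bound is v/(2u) for every u > 0; this u makes it smaller than E.
    have h1 := h ((v + 1) / E) (by positivity)
    have e : v / (2 * ((v + 1) / E)) = E * (v / (2 * (v + 1))) := by field_simp
    have h2 : v / (2 * (v + 1)) < 1 := by
      rw [div_lt_one (by positivity)]
      linarith
    rw [e] at h1
    nlinarith
  rcases hv.eq_or_lt with rfl | hv
  · have h1 := h (R / 4) (by positivity)
    simp only [zero_div, Real.sqrt_zero, zero_mul] at h1 ⊢
    linarith
  · have ha : 0 < Real.sqrt v := Real.sqrt_pos.2 hv
    have hb : 0 < Real.sqrt (3 * L) := Real.sqrt_pos.2 (by positivity)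
    have hb2 : Real.sqrt (3 * L) ^ 2 = 3 * L := Real.sq_sqrt (by positivity)
    have ha2 : Real.sqrt v ^ 2 = v := Real.sq_sqrt hv.le
    generalize Real.sqrt v = a at *
    generalize Real.sqrt (3 * L) = b at *
    -- This u balances the bound up to constants: Lu + v/(2u) = (1/3 + 1/2)ab, below the target ab.
    have h1 := h (a / b) (by positivity)
    obtain rfl : L = b ^ 2 / 3 := by linarith
    subst ha2
    have e : b ^ 2 / 3 * (a / b + 3 / 4 * R) + a ^ 2 / (2 * (a / b)) =
        5 / 6 * (a * b) + 3 / 4 * R * (b ^ 2 / 3) := by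
      field_simp
      ring
    rw [e] at h1
    have : 0 < a * b := by positivity
    have : 0 < R * (b ^ 2 / 3) := by positivity
    linarith

end NormBounds

/-- At a zero denominator the Lean quotient is 0, so the exponential bound there is only d. The
separate clause records that the probability is 0 when t > 0. The case R = 0 is treated apart: the
sum then vanishes almost surely. -/
theorem mainTheorem10 {Ω : Type*} [MeasurableSpace Ω] (μ : Measure Ω) [IsProbabilityMeasure μ]
    (d₁ d₂ n : ℕ) (hd : 0 < d₁ + d₂)
    (Z : Fin n → Ω → Matrix (Fin d₁) (Fin d₂) ℂ)
    (hmeas : ∀ k, Measurable (Z k))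
    (hindep : iIndepFun Z μ)
    (hmean : ∀ k, ∫ ω, Z k ω ∂μ = 0)
    (R : ℝ) (hR : 0 ≤ R)
    (hbound : ∀ k, ∀ᵐ ω ∂μ, ‖Z k ω‖ ≤ R) :
    (∀ t : ℝ, 0 ≤ t →
      μ.real {ω | t ≤ ‖∑ k, Z k ω‖} ≤
          ((d₁ + d₂ : ℕ) : ℝ) * Real.exp (-t ^ 2 / (3 * matrixVariance μ Z + 2 * R * t)) ∧
        (0 < t → 3 * matrixVariance μ Z + 2 * R * t = 0 →
          μ.real {ω | t ≤ ‖∑ k, Z k ω‖} = 0)) ∧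
    Integrable (fun ω => ‖∑ k, Z k ω‖) μ ∧
    ∫ ω, ‖∑ k, Z k ω‖ ∂μ ≤
      Real.sqrt (matrixVariance μ Z) * Real.sqrt (3 * Real.log ((d₁ + d₂ : ℕ) : ℝ)) +
        R * Real.log ((d₁ + d₂ : ℕ) : ℝ) := by

  have hd1 : (1 : ℝ) ≤ ((d₁ + d₂ : ℕ) : ℝ) := Nat.one_le_cast.2 hd
  have hzero : R = 0 → ∀ᵐ ω ∂μ, ‖∑ k, Z k ω‖ = 0 := by
    intro h
    filter_upwards [ae_norm_sum_le (s := Finset.univ) fun j _ => hbound j] with ω hω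
    rw [h, smul_zero] at hω
    exact le_antisymm hω (norm_nonneg _)
  have htail : R = 0 → ∀ t : ℝ, 0 < t → μ.real {ω | t ≤ ‖∑ k, Z k ω‖} = 0 := by
    intro h t ht
    rw [measureReal_eq_zero_iff, measure_eq_zero_iff_ae_notMem]
    filter_upwards [hzero h] with ω hω hmem
    rw [hω] at hmem
    exact absurd hmem ht.not_ge
  have hv : 0 ≤ matrixVariance μ Z := matrixVariance_nonneg
  refine ⟨fun t ht => ⟨?_, fun ht' hden => ?_⟩, integrable_norm_sum hmeas hbound, ?_⟩
  · rcases ht.eq_or_lt with rfl | ht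
    · rw [zero_pow two_ne_zero, neg_zero, zero_div, Real.exp_zero, mul_one]
      exact measureReal_le_one.trans hd1
    · rcases hR.eq_or_lt with h | hR
      · rw [htail h.symm t ht]
        positivity
      · exact measureReal_norm_sum_ge_le hd hmeas hindep hmean hR hbound ht
  · refine htail ?_ t ht'
    -- Both terms of the denominator are nonnegative, so with t > 0 its vanishing forces R = 0.
    by_contra hR0
    have : 0 < R * t := mul_pos (hR.lt_of_ne' hR0) ht'
    linarith
  · rcases hR.eq_or_lt with h | hR
    · rw [integral_congr_ae (hzero h.symm), integral_zero]
      have := Real.log_nonneg hd1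
      positivity
    · exact integral_norm_sum_le hd hmeas hindep hmean hR hbound
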